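/- All graphs are finite, simple and undirected. For a graph $G$ let $\mathrm{OPT}(G)$ be the minimum size of a vertex cover of $G$, and let $$\mathrm{LP}(G)=\min\Big\{\sum_{v\in V(G)}x_v \;\Big|\; x_u+x_v\ge 1 \text{ for all } \{u,v\}\in E(G),\ 0\le x_v\le 1 \text{ for all } v\in V(G)\Big\}.$$ Let $\mathcal{C}_{\mathrm{LP}}$ be the class of all graphs $G$ with $\mathrm{OPT}(G)=\mathrm{LP}(G)$. For a graph class $\mathcal{C}$, the elimination distance $\mathrm{ed}_{\mathcal{C}}(G)$ of $G$ to $\mathcal{C}$ is defined recursively: it is $0$ if $G\in\mathcal{C}$; it is $1+\min_{v\in V(G)}\mathrm{ed}_{\mathcal{C}}(G-v)$ if $G\notin\mathcal{C}$ and $G$ is connected; and it is the maximum of $\mathrm{ed}_{\mathcal{C}}(G_i)$ over the connected components $G_i$ of $G$ if $G\notin\mathcal{C}$ and $G$ is disconnected. A set $Y\subseteq V(G)$ is a blocking set of $G$ if no vertex cover of $G$ of size $\mathrm{OPT}(G)$ contains $Y$; it is a minimal blocking set if, moreover, no strict subset of $Y$ is a blocking set. Let $\beta_{\mathcal{C}}$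 be the largest size of a minimal blocking set of a graph in $\mathcal{C}$ ($\infty$ if these sizes are unbounded), and let $\beta_{\mathcal{C}}(d)$ be the largest size of a minimal blocking set of a graph $G$ with $\mathrm{ed}_{\mathcal{C}}(G)\le d$. Corollary. One has $\beta_{\mathcal{C}_{\mathrm{LP}}}=2$, and for every integer $d\ge 0$ $$\beta_{\mathcal{C}_{\mathrm{LP}}}(d)\;\le\;(\beta_{\mathcal{C}_{\mathrm{LP}}}+d-1)\cdot 2^d+1\;=\;(d+1)\cdot 2^d+1 .$$ In particular, every minimal blocking set of a graph of elimination distance at most $d$ to $\mathcal{C}_{\mathrm{LP}}$ has at most $(d+1)\cdot 2^d+1$ vertices. -/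

import Mathlib

universe u

namespace VCBlocking

/-- A class of finite simple graphs (on vertex types in the universe `u`). -/
def GraphClass : Type (u + 1) := ∀ (V : Type u) [Finite V], SimpleGraph V → Prop

section Graph

variable {V : Type u}

/-- The feasible solutions of the linear programming relaxation of Vertex Cover. -/
def IsFractionalVertexCover (G : SimpleGraph V) (x : V → ℝ) : Prop :=
  (∀ u v : V, G.Adj u v → 1 ≤ x u + x v) ∧ ∀ v : V, 0 ≤ x v ∧ x v ≤ 1

/-- `LP(G)`: the optimum value of the linear programming relaxation of Vertex Cover.
The infimum is a minimum, see `isLeast_vertexCoverLP`. -/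
noncomputable def vertexCoverLP (G : SimpleGraph V) : ℝ :=
  sInf {r : ℝ | ∃ x : V → ℝ, IsFractionalVertexCover G x ∧ r = ∑ᶠ v, x v}

theorem isLeast_vertexCoverLP [Finite V] (G : SimpleGraph V) :
    IsLeast {r : ℝ | ∃ x : V → ℝ, IsFractionalVertexCover G x ∧ r = ∑ᶠ v, x v}
      (vertexCoverLP G) := by
  have := Fintype.ofFinite V
  have hset : {r : ℝ | ∃ x : V → ℝ, IsFractionalVertexCover G x ∧ r = ∑ᶠ v, x v} =
      (fun x : V → ℝ => ∑ v, x v) '' {x | IsFractionalVertexCover G x} := by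
    ext r
    simp [finsum_eq_sum_of_fintype, eq_comm]
  have hclosed : IsClosed {x : V → ℝ | IsFractionalVertexCover G x} := by
    simp only [IsFractionalVertexCover, Set.ofPred_and, Set.ofPred_forall]
    refine IsClosed.inter ?_ ?_
    · refine isClosed_iInter fun u => isClosed_iInter fun v => isClosed_iInter fun _ => ?_
      exact isClosed_le (by fun_prop) (by fun_prop)
    · refine isClosed_iInter fun v => IsClosed.inter ?_ ?_
      · exact isClosed_le (by fun_prop) (by fun_prop)
      · exact isClosed_le (by fun_prop) (by fun_prop)
  have hcompact : IsCompact {x : V → ℝ | IsFractionalVertexCover G x} :=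
    (isCompact_univ_pi fun _ : V => isCompact_Icc (a := (0 : ℝ)) (b := 1)).of_isClosed_subset
      hclosed fun x hx v _ => hx.2 v
  have hne : {x : V → ℝ | IsFractionalVertexCover G x}.Nonempty :=
    ⟨fun _ => 1, fun _ _ _ => by norm_num, fun _ => by norm_num⟩
  have h := (hcompact.image (f := fun x : V → ℝ => ∑ v, x v) (by fun_prop)).isLeast_sInf
    (hne.image _)
  rw [← hset] at h
  exact h

/-- `Y` is a blocking set of `G` if no minimum vertex cover of `G` contains `Y`. -/
def IsBlockingSet (G : SimpleGraph V) (Y : Set V) : Prop :=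
  ¬ ∃ S : Set V, G.IsVertexCover S ∧ S.encard = G.vertexCoverNum ∧ Y ⊆ S

/-- A blocking set is minimal if no strict subset of it is a blocking set. -/
def IsMinimalBlockingSet (G : SimpleGraph V) (Y : Set V) : Prop :=
  IsBlockingSet G Y ∧ ∀ Z : Set V, Z ⊂ Y → ¬ IsBlockingSet G Z

/-- The size of a largest minimal blocking set of `G`. -/
noncomputable def blockingNum (G : SimpleGraph V) : ℕ∞ :=
  ⨆ (Y : Set V) (_ : IsMinimalBlockingSet G Y), Y.encard

end Graph

theorem natCard_deleteVert_lt {V : Type u} [Finite V] (v : V) :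
    Nat.card ({v}ᶜ : Set V) < Nat.card V :=
  Finite.card_subtype_lt (x := v) (by simp)

theorem natCard_supp_lt {V : Type u} [Finite V] {G : SimpleGraph V} (h : ¬ G.Connected)
    (c : G.ConnectedComponent) : Nat.card c.supp < Nat.card V := by
  obtain ⟨x, hx⟩ : ∃ x, x ∉ c.supp := by
    by_contra! hall
    obtain ⟨v, _⟩ := c.nonempty_supp
    refine h ((SimpleGraph.connected_iff G).2 ⟨fun a b => ?_, ⟨v⟩⟩)
    exact SimpleGraph.ConnectedComponent.exact ((hall a).trans (hall b).symm)
  exact Finite.card_subtype_lt hx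

open Classical in
/-- The elimination distance of a finite graph to the class `C`: it is `0` for graphs in `C`; for a
connected graph outside `C` it is one more than the minimum over all single-vertex deletions; for a
disconnected graph outside `C` it is the maximum over the connected components. -/
noncomputable def elimDist (C : GraphClass.{u}) (V : Type u) [Finite V] (G : SimpleGraph V) : ℕ∞ :=
  if C V G then 0
  else if h : G.Connected then
    (⨅ v : V, elimDist C ({v}ᶜ : Set V) (G.induce ({v}ᶜ : Set V))) + 1
  else
    ⨆ c : G.ConnectedComponent, elimDist C c.supp (G.induce c.supp)
termination_by Nat.card V
decreasing_by
  · exact natCard_deleteVert_lt v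
  · exact natCard_supp_lt h c

/-- The largest size of a minimal blocking set of a graph in `C` (`⊤` if it is unbounded). -/
noncomputable def classBlockingNum (C : GraphClass.{u}) : ℕ∞ :=
  ⨆ (V : Type u) (_ : Finite V) (G : SimpleGraph V) (_ : C V G), blockingNum G

/-- The class of all finite graphs of elimination distance at most `d` to `C`. -/
def elimDistLE (C : GraphClass.{u}) (d : ℕ) : GraphClass.{u} :=
  fun V _ G => elimDist C V G ≤ d

/-- The class of finite graphs whose vertex cover number equals the optimum value of the linear
programming relaxation. -/
def classLP : GraphClass.{u} :=
  fun _ _ G => (G.vertexCoverNum.toNat : ℝ) = vertexCoverLP G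

end VCBlocking

/-!
Fix a graph `G` and write `cost X` (`coverCost G X`) for the minimum size of a vertex cover that
contains `X`, so that `OPT = cost ∅`, and `Y` is blocking iff `cost ∅ < cost Y`. The following
more general statement is proved: if `cost X ≤ OPT + j` and `cost X < cost (X ∪ Y)`, then
`cost X < cost (X ∪ Z)` for some `Z ⊆ Y` of size at most `blockingBound d j`, where `d` bounds the
elimination distance. For `X = ∅` and `j = 0` a minimal blocking set `Y` has to be equal to `Z`.

The cost is additive over connected components (`coverCost_eq_sum_component`), so a disconnected
graph reduces to one of its components. If a vertex `v` is deleted, a vertex cover either contains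
`v`, which leaves `j` as it is, or it contains all neighbors of `v`, which are then added to `X` and
increase `j` by at most one (`coverCost_of_notMem`). The cost has to be raised in both cases, whence
the recursion `blockingBound (d + 1) j = blockingBound d j + blockingBound d (j + 1)`
(`exists_subset_coverCost_lt_of_deleteVert`).

For a graph with `OPT = LP` the bound is `j + 2` (`exists_subset_coverCost_lt_of_signedBound`).
Half-integral fractional vertex covers (half-covers for short) are encoded as functions with values
in `{-1, 0, 1}` (`IsSignedCover`). They are closed under the operations `signedJoin` and
`signedMeet`, which preserve the total sum, so these operations preserve minimum half-covers.
Rounding a half-cover by a vertex cover (`coverCost_le_of_isSignedCover`) shows that forcing `X`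
into the half-covers raises their relaxed optimum by at least half of `cost X - OPT`, so the gap
between `cost X` and the relaxed optimum is at most `j / 2`. Now force vertices of `Y` into `X`. As
long as a single vertex raises the relaxed optimum, it closes the gap by at least `1 / 2`. If no
single vertex does, but two vertices together do, then they close the gap by at least `1`
(`SignedBound.insert_insert`). If no pair does either, then a minimum half-cover is `1` on all of
`Y` (`SignedBound.exists_union`), and rounding it shows that `Y` does not raise the cost. Hence one
vertex is spent per `1 / 2` of the gap, and at most two more at the end, when a vertex or a pair
raises the cost itself.
-/

namespace VCBlocking

open SimpleGraph

/-! ### Vertex covers that contain a given set -/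

section CoverCost

variable {V : Type*} {G : SimpleGraph V} {X Y S : Set V}

/-- The minimum size of a vertex cover of `G` that contains `X`. -/
noncomputable def coverCost (G : SimpleGraph V) (X : Set V) : ℕ :=
  sInf {n | ∃ S : Set V, G.IsVertexCover S ∧ X ⊆ S ∧ S.ncard = n}

theorem exists_ncard_eq_coverCost (G : SimpleGraph V) (X : Set V) :
    ∃ S : Set V, G.IsVertexCover S ∧ X ⊆ S ∧ S.ncard = coverCost G X :=
  Nat.sInf_mem (s := {n | ∃ S : Set V, G.IsVertexCover S ∧ X ⊆ S ∧ S.ncard = n})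
    ⟨_, Set.univ, isVertexCover_univ, Set.subset_univ X, rfl⟩

theorem coverCost_le (hS : G.IsVertexCover S) (hX : X ⊆ S) : coverCost G X ≤ S.ncard :=
  Nat.sInf_le ⟨S, hS, hX, rfl⟩

theorem coverCost_mono (h : X ⊆ Y) : coverCost G X ≤ coverCost G Y := by
  obtain ⟨S, hS, hYS, hc⟩ := exists_ncard_eq_coverCost G Y
  exact hc ▸ coverCost_le hS (h.trans hYS)

variable [Finite V]

theorem vertexCoverNum_eq_coverCost (G : SimpleGraph V) :
    G.vertexCoverNum = coverCost G ∅ := by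
  apply le_antisymm
  · obtain ⟨S, hS, -, hc⟩ := exists_ncard_eq_coverCost G ∅
    rw [← hc, S.toFinite.cast_ncard_eq]
    exact hS.vertexCoverNum_le
  · obtain ⟨S, hc, hS⟩ := vertexCoverNum_exists G
    rw [← hc, ← S.toFinite.cast_ncard_eq, Nat.cast_le]
    exact coverCost_le hS (Set.empty_subset S)

theorem isBlockingSet_iff : IsBlockingSet G Y ↔ coverCost G ∅ < coverCost G Y := by
  rw [IsBlockingSet, vertexCoverNum_eq_coverCost, not_iff_comm, not_lt]
  constructor
  · intro h
    obtain ⟨S, hS, hY, hc⟩ := exists_ncard_eq_coverCost G Y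
    refine ⟨S, hS, ?_, hY⟩
    rw [← S.toFinite.cast_ncard_eq, hc, le_antisymm h (coverCost_mono (Set.empty_subset Y))]
  · rintro ⟨S, hS, hc, hY⟩
    rw [← S.toFinite.cast_ncard_eq, Nat.cast_inj] at hc
    exact hc ▸ coverCost_le hS hY

end CoverCost

/-! ### Signed covers -/

section SignedCover

variable {V : Type*} {G : SimpleGraph V} {X Y S : Set V} {f g : V → ℤ}

/-- A half-integral fractional vertex cover `x` of `G` that is `1` on `X`, encoded by the integral
function `2 * x - 1`, whose values are `-1`, `0` and `1`. -/
def IsSignedCover (G : SimpleGraph V) (X : Set V) (f : V → ℤ) : Prop :=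
  (∀ u v, G.Adj u v → 0 ≤ f u + f v) ∧ (∀ v, -1 ≤ f v ∧ f v ≤ 1) ∧ ∀ v ∈ X, f v = 1

/-- The sign of `f + g`, for functions with values in `{-1, 0, 1}`. -/
def signedJoin (f g : V → ℤ) (v : V) : ℤ := max (-1) (min 1 (f v + g v))

/-- The median of `f`, `g` and `0`: the common value where `f` and `g` have the same sign, and `0`
elsewhere, for functions with values in `{-1, 0, 1}`. -/
def signedMeet (f g : V → ℤ) (v : V) : ℤ := max (min (f v) (g v)) (min 0 (max (f v) (g v)))

open Classical in
/-- The signed cover that belongs to a set of vertices. -/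
noncomputable def signOf (S : Set V) (v : V) : ℤ := if v ∈ S then 1 else -1

theorem IsSignedCover.mono (h : X ⊆ Y) (hf : IsSignedCover G Y f) : IsSignedCover G X f :=
  ⟨hf.1, hf.2.1, fun v hv => hf.2.2 v (h hv)⟩

theorem IsSignedCover.join (hf : IsSignedCover G X f) (hg : IsSignedCover G X g) :
    IsSignedCover G X (signedJoin f g) := by
  refine ⟨fun u v huv => ?_, fun v => ?_, fun v hv => ?_⟩ <;> simp only [signedJoin]
  · have := hf.1 u v huv
    have := hg.1 u v huv
    omega
  · omega
  · have := hf.2.2 v hv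
    have := hg.2.2 v hv
    omega

theorem IsSignedCover.meet (hf : IsSignedCover G X f) (hg : IsSignedCover G X g) :
    IsSignedCover G X (signedMeet f g) := by
  refine ⟨fun u v huv => ?_, fun v => ?_, fun v hv => ?_⟩ <;> simp only [signedMeet]
  · have := hf.1 u v huv
    have := hg.1 u v huv
    omega
  · have := hf.2.1 v
    have := hg.2.1 v
    omega
  · have := hf.2.2 v hv
    have := hg.2.2 v hv
    omega

theorem isSignedCover_signOf (hS : G.IsVertexCover S) (hX : X ⊆ S) :
    IsSignedCover G X (signOf S) := by
  refine ⟨fun u v huv => ?_, fun v => ?_, fun v hv => if_pos (hX hv)⟩ <;> simp only [signOf]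
  · rcases hS huv with h | h <;> rw [if_pos h] <;> split_ifs <;> norm_num
  · split_ifs <;> norm_num

variable [Fintype V]

theorem sum_signedJoin_add_sum_signedMeet (hf : IsSignedCover G X f) (hg : IsSignedCover G X g) :
    ∑ v, signedJoin f g v + ∑ v, signedMeet f g v = ∑ v, f v + ∑ v, g v := by
  rw [← Finset.sum_add_distrib, ← Finset.sum_add_distrib]
  refine Finset.sum_congr rfl fun v _ => ?_
  have := hf.2.1 v
  have := hg.2.1 v
  simp only [signedJoin, signedMeet]
  omega

theorem sum_signOf (S : Set V) : ∑ v, signOf S v = 2 * (S.ncard : ℤ) - Fintype.card V := by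
  classical
  have h : ∀ v, signOf S v = 2 * (if v ∈ S then 1 else 0) - 1 := fun v => by
    unfold signOf
    split_ifs <;> norm_num
  simp only [h, Finset.sum_sub_distrib, ← Finset.mul_sum, Finset.sum_boole]
  simp [Set.ncard_eq_toFinset_card', Set.toFinset]

/-- Rounding a signed cover `f` by a vertex cover `S`: the set where `f` is `1`, together with the
part of `S` where `f` is `0`, is a vertex cover. -/
theorem coverCost_le_of_isSignedCover (hf : IsSignedCover G Y f) (hS : G.IsVertexCover S) :
    2 * (coverCost G Y : ℤ) - Fintype.card V ≤
      2 * (S.ncard : ℤ) - Fintype.card V + 2 * (∑ v, f v - ∑ v, signedMeet f (signOf S) v) := by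
  set T : Set V := {v | f v = 1 ∨ f v = 0 ∧ v ∈ S} with hT
  have hTc : G.IsVertexCover T := by
    intro u v huv
    have h1 := hf.1 u v huv
    have h2 := hf.2.1 u
    have h3 := hf.2.1 v
    have h4 := hS huv
    simp only [hT, Set.mem_ofPred_eq]
    by_cases hu : f u = 1
    · exact Or.inl (Or.inl hu)
    by_cases hv : f v = 1
    · exact Or.inr (Or.inl hv)
    have hu0 : f u = 0 := by omega
    have hv0 : f v = 0 := by omega
    exact h4.imp (fun h => Or.inr ⟨hu0, h⟩) fun h => Or.inr ⟨hv0, h⟩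
  have hcost := coverCost_le hTc fun v hv => Or.inl (hf.2.2 v hv)
  have hsum : ∑ v, signOf T v =
      ∑ v, signOf S v + 2 * (∑ v, f v - ∑ v, signedMeet f (signOf S) v) := by
    rw [← Finset.sum_sub_distrib, Finset.mul_sum, ← Finset.sum_add_distrib]
    refine Finset.sum_congr rfl fun v _ => ?_
    have h2 := hf.2.1 v
    by_cases hv : v ∈ S <;> simp only [signOf, signedMeet, hT, Set.mem_ofPred_eq, hv, if_true,
      if_false, and_true, and_false, or_false] <;> split_ifs <;> omega
  rw [sum_signOf, sum_signOf] at hsum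
  omega

/-- `b` is a lower bound for the sums of the signed covers that are `1` on `X`. -/
def SignedBound (G : SimpleGraph V) (X : Set V) (b : ℤ) : Prop :=
  ∀ f, IsSignedCover G X f → b ≤ ∑ v, f v

variable {b : ℤ}

/-- If some minimum signed cover is `1` at `y`, then a signed cover `g` that is `1` at `y` and `z`
and is off the minimum by one yields a minimum one that is `1` at `y` and nonnegative at `z`. -/
theorem SignedBound.exists_nonneg (hb : SignedBound G X b) {y z : V}
    (hf : IsSignedCover G X f) (hfy : f y = 1) (hfb : ∑ v, f v ≤ b)
    (hg : IsSignedCover G X g) (hgy : g y = 1) (hgz : g z = 1) (hgb : ∑ v, g v ≤ b + 1) :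
    ∃ h, IsSignedCover G X h ∧ h y = 1 ∧ 0 ≤ h z ∧ ∑ v, h v ≤ b := by
  have hj := hb _ (hf.join hg)
  have hm := hb _ (hf.meet hg)
  have hs := sum_signedJoin_add_sum_signedMeet hf hg
  by_cases hz : 0 ≤ f z
  · exact ⟨f, hf, hfy, hz, hfb⟩
  have hz' := hf.2.1 z
  by_cases hj' : ∑ v, signedJoin f g v ≤ b
  · refine ⟨_, hf.join hg, ?_, ?_, hj'⟩ <;> simp only [signedJoin] <;> omega
  · refine ⟨_, hf.meet hg, ?_, ?_, by omega⟩ <;> simp only [signedMeet] <;> omega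

/-- Suppose that each of two vertices can be forced into a signed cover without raising the minimum
`b`. If forcing both raises the minimum, then it does so by at least two. -/
theorem SignedBound.insert_insert (hb : SignedBound G X b) {y z : V}
    (hy : ∃ f, IsSignedCover G X f ∧ f y = 1 ∧ ∑ v, f v ≤ b)
    (hz : ∃ f, IsSignedCover G X f ∧ f z = 1 ∧ ∑ v, f v ≤ b)
    (hyz : ¬ ∃ f, IsSignedCover G X f ∧ f y = 1 ∧ f z = 1 ∧ ∑ v, f v ≤ b) :
    SignedBound G (insert y (insert z X)) (b + 2) := by
  intro g hg
  by_contra! hlt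
  have hgy : g y = 1 := hg.2.2 y (by simp)
  have hgz : g z = 1 := hg.2.2 z (by simp)
  have hgX : IsSignedCover G X g := hg.mono (by grind)
  obtain ⟨f₁, hf₁, hf₁y, hf₁b⟩ := hy
  obtain ⟨f₂, hf₂, hf₂z, hf₂b⟩ := hz
  obtain ⟨h₁, hh₁, hh₁y, hh₁z, hh₁b⟩ :=
    hb.exists_nonneg hf₁ hf₁y hf₁b hgX hgy hgz (by omega)
  obtain ⟨h₂, hh₂, hh₂z, hh₂y, hh₂b⟩ :=
    hb.exists_nonneg hf₂ hf₂z hf₂b hgX hgz hgy (by omega)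
  have hm := hb _ (hh₁.meet hh₂)
  have hs := sum_signedJoin_add_sum_signedMeet hh₁ hh₂
  refine hyz ⟨_, hh₁.join hh₂, ?_, ?_, by omega⟩ <;> simp only [signedJoin] <;> omega

/-- Pairwise compatible vertices can be forced into a minimum signed cover simultaneously. -/
theorem SignedBound.exists_union (hb : SignedBound G X b)
    (h₀ : ∃ f, IsSignedCover G X f ∧ ∑ v, f v ≤ b)
    (hY : ∀ y ∈ Y, ∀ z ∈ Y, ∃ f, IsSignedCover G X f ∧ f y = 1 ∧ f z = 1 ∧ ∑ v, f v ≤ b) :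
    ∃ f, IsSignedCover G (X ∪ Y) f ∧ ∑ v, f v ≤ b := by
  classical
  -- The meet, over all `y` in `Y`, of minimum signed covers that are `1` at `z` and `y`.
  have hz : ∀ z ∈ Y, ∃ f, IsSignedCover G X f ∧ f z = 1 ∧ (∀ y ∈ Y, 0 ≤ f y) ∧ ∑ v, f v ≤ b := by
    intro z hz
    have hA : ∀ A : Set V, A.Finite → A ⊆ Y →
        ∃ f, IsSignedCover G X f ∧ f z = 1 ∧ (∀ y ∈ A, 0 ≤ f y) ∧ ∑ v, f v ≤ b := by
      intro A hA
      induction A, hA using Set.Finite.induction_on with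
      | empty =>
        intro _
        obtain ⟨f, hf, hfz, -, hfb⟩ := hY z hz z hz
        exact ⟨f, hf, hfz, by simp, hfb⟩
      | @insert a A _ _ ih =>
        intro hsub
        obtain ⟨f, hf, hfz, hfA, hfb⟩ := ih ((Set.subset_insert a A).trans hsub)
        obtain ⟨g, hg, hgz, hga, hgb⟩ := hY z hz a (hsub (Set.mem_insert a A))
        have hj := hb _ (hf.join hg)
        have hs := sum_signedJoin_add_sum_signedMeet hf hg
        refine ⟨_, hf.meet hg, ?_, ?_, by omega⟩
        · simp only [signedMeet]
          omega
        · intro y hy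
          have := hf.2.1 y
          simp only [signedMeet]
          rcases hy with rfl | hy
          · omega
          · have := hfA y hy
            omega
    exact hA Y Y.toFinite subset_rfl
  -- The join of these functions over all `z` in `Y`.
  have hA : ∀ A : Set V, A.Finite → A ⊆ Y → ∃ f, IsSignedCover G X f ∧ (∀ y ∈ A, f y = 1) ∧
      (A.Nonempty → ∀ y ∈ Y, 0 ≤ f y) ∧ ∑ v, f v ≤ b := by
    intro A hA
    induction A, hA using Set.Finite.induction_on with
    | empty =>
      intro _
      obtain ⟨f, hf, hfb⟩ := h₀
      exact ⟨f, hf, by simp, by simp, hfb⟩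
    | @insert a A _ _ ih =>
      intro hsub
      obtain ⟨f, hf, hfA, hfY, hfb⟩ := ih ((Set.subset_insert a A).trans hsub)
      obtain ⟨g, hg, hga, hgY, hgb⟩ := hz a (hsub (Set.mem_insert a A))
      rcases A.eq_empty_or_nonempty with rfl | hne
      · exact ⟨g, hg, by simpa using hga, fun _ => hgY, hgb⟩
      have hm := hb _ (hf.meet hg)
      have hs := sum_signedJoin_add_sum_signedMeet hf hg
      refine ⟨_, hf.join hg, ?_, fun _ y hy => ?_, by omega⟩
      · intro y hy
        have h1 := hgY y (hsub hy)
        have h2 := hfY hne y (hsub hy)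
        simp only [signedJoin]
        rcases hy with rfl | hy
        · omega
        · have := hfA y hy
          omega
      · have h1 := hgY y hy
        have h2 := hfY hne y hy
        simp only [signedJoin]
        omega
  obtain ⟨f, hf, hfY, -, hfb⟩ := hA Y Y.toFinite subset_rfl
  exact ⟨f, ⟨hf.1, hf.2.1, fun v hv => hv.elim (hf.2.2 v) (hfY v)⟩, hfb⟩

/-- If the minimum size of a vertex cover containing `X` exceeds its half-integral relaxation by at
most `j / 2`, then `j + 2` vertices of `Y` suffice to raise it whenever `Y` does. The proof forces
vertices of `Y` into the cover, in such a way that every one of them lowers `j` by one, until one or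
two further vertices are enough. -/
theorem SignedBound.exists_subset_coverCost_lt (j : ℕ) (hb : SignedBound G X b)
    (hj : 2 * (coverCost G X : ℤ) - Fintype.card V ≤ b + j)
    (hY : coverCost G X < coverCost G (X ∪ Y)) :
    ∃ Z ⊆ Y, Z.ncard ≤ j + 2 ∧ coverCost G X < coverCost G (X ∪ Z) := by
  induction j using Nat.strong_induction_on generalizing X b with
  | _ j ih =>
  -- Forcing a set `A` into the cover pays off if that raises the bound `b` by the size of `A`.
  have step : ∀ A ⊆ Y, 0 < A.ncard → coverCost G (X ∪ A) ≤ coverCost G X →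
      SignedBound G (X ∪ A) (b + A.ncard) →
      ∃ Z ⊆ Y, Z.ncard ≤ j + 2 ∧ coverCost G X < coverCost G (X ∪ Z) := by
    intro A hAY hA hcost hbA
    have hc := le_antisymm hcost (coverCost_mono Set.subset_union_left)
    obtain ⟨S, hS, hXS, hSc⟩ := exists_ncard_eq_coverCost G (X ∪ A)
    have hσ := hbA _ (isSignedCover_signOf hS hXS)
    rw [sum_signOf, hSc] at hσ
    have hcAY : coverCost G (X ∪ A ∪ Y) = coverCost G (X ∪ Y) := by
      rw [Set.union_assoc, Set.union_eq_self_of_subset_left hAY]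
    obtain ⟨Z, hZY, hZ, hZc⟩ := ih (j - A.ncard) (by omega) hbA (by omega) (by omega)
    refine ⟨A ∪ Z, Set.union_subset hAY hZY, ?_, ?_⟩
    · have := Set.ncard_union_le A Z
      omega
    · rw [← Set.union_assoc]
      omega
  by_contra hcon
  have hfree : ∀ y ∈ Y, ∃ f, IsSignedCover G X f ∧ f y = 1 ∧ ∑ v, f v ≤ b := by
    intro y hy
    by_contra hno
    have hcost : coverCost G (X ∪ {y}) ≤ coverCost G X := by
      by_contra! hlt
      exact hcon ⟨{y}, by simpa using hy, by simp, hlt⟩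
    refine hcon (step {y} (by simpa using hy) (by simp) hcost ?_)
    intro f hf
    by_contra! hlt
    rw [Set.ncard_singleton] at hlt
    exact hno ⟨f, hf.mono Set.subset_union_left, hf.2.2 y (by simp), by push_cast at hlt; omega⟩
  have hpair : ∀ y ∈ Y, ∀ z ∈ Y,
      ∃ f, IsSignedCover G X f ∧ f y = 1 ∧ f z = 1 ∧ ∑ v, f v ≤ b := by
    intro y hy z hz
    by_contra hno
    have hyz : y ≠ z := by
      rintro rfl
      obtain ⟨f, hf, hfy, hfb⟩ := hfree y hy
      exact hno ⟨f, hf, hfy, hfy, hfb⟩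
    have hsub : ({y, z} : Set V) ⊆ Y := by
      rintro w (rfl | rfl) <;> assumption
    have hcost : coverCost G (X ∪ {y, z}) ≤ coverCost G X := by
      by_contra! hlt
      exact hcon ⟨{y, z}, hsub, by simp [Set.ncard_pair hyz], hlt⟩
    refine hcon (step {y, z} hsub (by simp [Set.ncard_pair hyz]) hcost ?_)
    rw [Set.ncard_pair hyz, Set.union_comm, Set.insert_union, Set.singleton_union]
    exact hb.insert_insert (hfree y hy) (hfree z hz) hno
  have hYne : Y.Nonempty := by
    rw [Set.nonempty_iff_ne_empty]
    rintro rfl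
    simp at hY
  obtain ⟨f, hf, hfb⟩ := hb.exists_union (by
    obtain ⟨y, hy⟩ := hYne
    obtain ⟨f, hf, -, hfb⟩ := hfree y hy
    exact ⟨f, hf, hfb⟩) hpair
  -- Rounding `f` by a minimum vertex cover containing `X` costs nothing, as `f` is a minimum.
  obtain ⟨S, hS, hXS, hSc⟩ := exists_ncard_eq_coverCost G X
  have hm := hb _ ((hf.mono Set.subset_union_left).meet (isSignedCover_signOf hS hXS))
  have hr := coverCost_le_of_isSignedCover hf hS
  omega

/-- If the signed covers have sum at least `2 * OPT - |V|`, and the minimum size of a vertex cover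
containing `X` is at most `OPT + j`, then `j + 2` vertices of `Y` suffice to raise it whenever `Y` does. -/
theorem exists_subset_coverCost_lt_of_signedBound (j : ℕ)
    (hb : SignedBound G ∅ (2 * (coverCost G ∅ : ℤ) - Fintype.card V))
    (hX : coverCost G X ≤ coverCost G ∅ + j) (hY : coverCost G X < coverCost G (X ∪ Y)) :
    ∃ Z ⊆ Y, Z.ncard ≤ j + 2 ∧ coverCost G X < coverCost G (X ∪ Z) := by
  -- Rounding by a minimum vertex cover shows that forcing `X` into the relaxation raises twice its
  -- optimum by at least `coverCost G X - coverCost G ∅`.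
  have hbX : SignedBound G X (2 * (coverCost G ∅ : ℤ) - Fintype.card V +
      (coverCost G X - coverCost G ∅)) := by
    intro f hf
    obtain ⟨S, hS, hXS, hSc⟩ := exists_ncard_eq_coverCost G ∅
    have hm := hb _ ((hf.mono (Set.empty_subset X)).meet (isSignedCover_signOf hS hXS))
    have hr := coverCost_le_of_isSignedCover hf hS
    omega
  exact hbX.exists_subset_coverCost_lt j (by omega) hY

end SignedCover

/-! ### Graphs whose vertex cover number equals the linear programming bound -/

theorem signedBound_of_classLP {V : Type u} [Fintype V] {G : SimpleGraph V} (h : classLP V G) :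
    SignedBound G ∅ (2 * (coverCost G ∅ : ℤ) - Fintype.card V) := by
  intro f hf
  have hLP : vertexCoverLP G ≤ ∑ v, ((f v : ℝ) + 1) / 2 := by
    refine (isLeast_vertexCoverLP G).2 ⟨_, ⟨fun u v huv => ?_, fun v => ?_⟩,
      (finsum_eq_sum_of_fintype _).symm⟩
    · have : (0 : ℝ) ≤ f u + f v := by exact_mod_cast hf.1 u v huv
      linarith
    · have h1 : (-1 : ℝ) ≤ f v := by exact_mod_cast (hf.2.1 v).1
      have h2 : (f v : ℝ) ≤ 1 := by exact_mod_cast (hf.2.1 v).2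
      constructor <;> linarith
  have hC : (coverCost G ∅ : ℝ) = vertexCoverLP G := by
    rw [← h, vertexCoverNum_eq_coverCost, ENat.toNat_natCast]
  rw [← hC, ← Finset.sum_div, Finset.sum_add_distrib] at hLP
  simp only [Finset.sum_const, Finset.card_univ, nsmul_eq_mul, mul_one] at hLP
  have : (2 * (coverCost G ∅ : ℝ) - Fintype.card V) ≤ ∑ v, (f v : ℝ) := by linarith
  exact_mod_cast this

theorem vertexCoverNum_top_bool : (⊤ : SimpleGraph (ULift.{u} Bool)).vertexCoverNum = 1 := by
  apply le_antisymm
  · have hc : (⊤ : SimpleGraph (ULift.{u} Bool)).IsVertexCover {⟨true⟩} := by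
      rintro ⟨_ | _⟩ ⟨_ | _⟩ h <;> simp_all
    simpa using hc.vertexCoverNum_le
  · rw [Order.one_le_iff_ne_zero, Ne, vertexCoverNum_eq_zero]
    exact top_ne_bot

/-- A single edge belongs to `classLP`: both optima are `1`. -/
theorem classLP_top_bool : classLP (ULift.{u} Bool) ⊤ := by
  have hsum : ∀ x : ULift.{u} Bool → ℝ, ∑ᶠ v, x v = x ⟨true⟩ + x ⟨false⟩ := by
    intro x
    rw [finsum_eq_sum_of_fintype, ← Equiv.sum_comp Equiv.ulift.symm]
    simp [Equiv.ulift]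
  rw [classLP, vertexCoverNum_top_bool]
  refine ((isLeast_vertexCoverLP _).unique
    ⟨⟨fun _ => 1 / 2, ⟨fun u v _ => ?_, fun v => ?_⟩, ?_⟩, ?_⟩).symm
  · norm_num
  · norm_num
  · rw [hsum]
    norm_num
  · rintro _ ⟨x, hx, rfl⟩
    rw [hsum]
    simpa using hx.1 ⟨true⟩ ⟨false⟩ (by simp)

theorem isMinimalBlockingSet_top_bool :
    IsMinimalBlockingSet (⊤ : SimpleGraph (ULift.{u} Bool)) Set.univ := by
  constructor
  · rintro ⟨S, -, hc, hS⟩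
    rw [Set.univ_subset_iff.1 hS, vertexCoverNum_top_bool, Set.encard_univ] at hc
    simp at hc
  · intro Z hZ
    obtain ⟨w, hw⟩ := (Set.ne_univ_iff_exists_notMem Z).1 hZ.ne
    rw [IsBlockingSet, not_not, vertexCoverNum_top_bool]
    refine ⟨{⟨!w.down⟩}, ?_, by simp, ?_⟩
    · obtain ⟨_ | _⟩ := w <;> rintro ⟨_ | _⟩ ⟨_ | _⟩ h <;> simp_all
    · intro z hz
      obtain ⟨_ | _⟩ := w <;> obtain ⟨_ | _⟩ := z <;> simp_all

/-! ### Connected components and vertex deletions -/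

section Decomposition

variable {V : Type*} {G : SimpleGraph V} {X Y S : Set V}

theorem isVertexCover_induce (hS : G.IsVertexCover S) (s : Set V) :
    (G.induce s).IsVertexCover ((↑) ⁻¹' S) :=
  fun _ _ h => hS h

theorem ncard_preimage_val (s S : Set V) : ((↑) ⁻¹' S : Set s).ncard = (s ∩ S).ncard := by
  rw [← Subtype.image_preimage_coe, Set.ncard_image_of_injective _ Subtype.val_injective]

theorem preimage_val_union_image (s X : Set V) (Z : Set s) :
    ((↑) ⁻¹' (X ∪ (↑) '' Z) : Set s) = (↑) ⁻¹' X ∪ Z := by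
  rw [Set.preimage_union, Set.preimage_image_eq _ Subtype.val_injective]

variable [Finite V]

theorem ncard_eq_sum_component (G : SimpleGraph V) [Fintype G.ConnectedComponent] (S : Set V) :
    S.ncard = ∑ c : G.ConnectedComponent, ((↑) ⁻¹' S : Set c.supp).ncard := by
  classical
  have := Fintype.ofFinite V
  rw [Set.ncard_eq_toFinset_card', Finset.card_eq_sum_card_fiberwise
    (f := G.connectedComponentMk) (t := Finset.univ) (fun _ _ => Finset.mem_univ _)]
  refine Finset.sum_congr rfl fun c _ => ?_
  rw [ncard_preimage_val, Set.ncard_eq_toFinset_card']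
  congr 1
  ext v
  simp [and_comm]

theorem coverCost_eq_sum_component (G : SimpleGraph V) [Fintype G.ConnectedComponent]
    (X : Set V) :
    coverCost G X = ∑ c : G.ConnectedComponent, coverCost (G.induce c.supp) ((↑) ⁻¹' X) := by
  apply le_antisymm
  · choose T hT hXT hc using fun c : G.ConnectedComponent =>
      exists_ncard_eq_coverCost (G.induce c.supp) ((↑) ⁻¹' X)
    set S : Set V := {v | ⟨v, rfl⟩ ∈ T (G.connectedComponentMk v)} with hS
    have hST : ∀ c : G.ConnectedComponent, ((↑) ⁻¹' S : Set c.supp) = T c := by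
      intro c
      ext ⟨v, rfl⟩
      rfl
    have hSc : G.IsVertexCover S := by
      intro u v huv
      have huv' : G.connectedComponentMk u = G.connectedComponentMk v :=
        ConnectedComponent.sound huv.reachable
      have := hT (G.connectedComponentMk v) (v := ⟨u, huv'⟩) (w := ⟨v, rfl⟩) huv
      rwa [← hST] at this
    refine (coverCost_le hSc fun v hv => hXT _ hv).trans ?_
    rw [ncard_eq_sum_component G S]
    exact Finset.sum_le_sum fun c _ => by rw [hST, hc]
  · obtain ⟨S, hS, hX, hc⟩ := exists_ncard_eq_coverCost G X
    rw [← hc, ncard_eq_sum_component G S]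
    exact Finset.sum_le_sum fun c _ =>
      coverCost_le (isVertexCover_induce hS _) (Set.preimage_mono hX)

/-- If `Y` raises the cost of `X`, then it does so in one of the connected components, in which the
cost of `X` exceeds the vertex cover number by no more than in the whole graph. -/
theorem exists_component_coverCost_lt {j : ℕ} (hX : coverCost G X ≤ coverCost G ∅ + j)
    (hY : coverCost G X < coverCost G (X ∪ Y)) : ∃ c : G.ConnectedComponent,
      coverCost (G.induce c.supp) ((↑) ⁻¹' X) ≤ coverCost (G.induce c.supp) ∅ + j ∧
      coverCost (G.induce c.supp) ((↑) ⁻¹' X) <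
        coverCost (G.induce c.supp) ((↑) ⁻¹' X ∪ (↑) ⁻¹' Y) := by
  classical
  have := Fintype.ofFinite G.ConnectedComponent
  rw [coverCost_eq_sum_component G X, coverCost_eq_sum_component G (X ∪ Y)] at hY
  obtain ⟨c, -, hc⟩ := Finset.exists_lt_of_sum_lt hY
  refine ⟨c, ?_, hc⟩
  rw [coverCost_eq_sum_component G X, coverCost_eq_sum_component G ∅,
    ← Finset.add_sum_erase _ _ (Finset.mem_univ c),
    ← Finset.add_sum_erase _ _ (Finset.mem_univ c)] at hX
  have : ∑ c' ∈ Finset.univ.erase c, coverCost (G.induce c'.supp) ((↑) ⁻¹' (∅ : Set V)) ≤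
      ∑ c' ∈ Finset.univ.erase c, coverCost (G.induce c'.supp) ((↑) ⁻¹' X) :=
    Finset.sum_le_sum fun c' _ => coverCost_mono (Set.preimage_mono (Set.empty_subset X))
  simp only [Set.preimage_empty] at hX this
  omega

theorem coverCost_lt_of_component {c : G.ConnectedComponent} {Z : Set c.supp}
    (h : coverCost (G.induce c.supp) ((↑) ⁻¹' X) <
      coverCost (G.induce c.supp) ((↑) ⁻¹' X ∪ Z)) :
    coverCost G X < coverCost G (X ∪ (↑) '' Z) := by
  have := Fintype.ofFinite G.ConnectedComponent
  rw [coverCost_eq_sum_component G X, coverCost_eq_sum_component G (X ∪ _)]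
  refine Finset.sum_lt_sum
    (fun c' _ => coverCost_mono (Set.preimage_mono Set.subset_union_left))
    ⟨c, Finset.mem_univ c, ?_⟩
  rwa [preimage_val_union_image]

theorem coverCost_of_mem {v : V} (hv : v ∈ X) :
    coverCost G X = coverCost (G.induce {v}ᶜ) ((↑) ⁻¹' X) + 1 := by
  apply le_antisymm
  · obtain ⟨T, hT, hXT, hc⟩ := exists_ncard_eq_coverCost (G.induce {v}ᶜ) ((↑) ⁻¹' X)
    have hS : G.IsVertexCover (insert v ((↑) '' T)) := by
      intro a b hab
      by_cases ha : a = v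
      · exact Or.inl (Or.inl ha)
      by_cases hb : b = v
      · exact Or.inr (Or.inl hb)
      have := hT (v := ⟨a, ha⟩) (w := ⟨b, hb⟩) hab
      exact this.imp (fun h => Or.inr ⟨_, h, rfl⟩) fun h => Or.inr ⟨_, h, rfl⟩
    refine (coverCost_le hS fun a ha => ?_).trans ?_
    · by_cases hav : a = v
      · exact Or.inl hav
      · exact Or.inr ⟨⟨a, hav⟩, hXT ha, rfl⟩
    · rw [← hc, ← Set.ncard_image_of_injective T Subtype.val_injective]
      exact Set.ncard_insert_le _ _
  · obtain ⟨S, hS, hX, hc⟩ := exists_ncard_eq_coverCost G X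
    have h := coverCost_le (isVertexCover_induce hS {v}ᶜ) (Set.preimage_mono hX)
    rw [ncard_preimage_val, Set.inter_comm, ← Set.sdiff_eq] at h
    have := Set.ncard_sdiff_singleton_add_one (hX hv) S.toFinite
    omega

/-- A vertex cover either contains the vertex `v` or contains all of its neighbors. -/
theorem coverCost_of_notMem {v : V} (hv : v ∉ X) :
    coverCost G X = min (coverCost (G.induce {v}ᶜ) ((↑) ⁻¹' X) + 1)
      (coverCost (G.induce {v}ᶜ) ((↑) ⁻¹' X ∪ (↑) ⁻¹' G.neighborSet v)) := by
  have hins : coverCost (G.induce {v}ᶜ) ((↑) ⁻¹' X) + 1 = coverCost G (insert v X) := by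
    rw [coverCost_of_mem (Set.mem_insert v X)]
    congr 2
    ext ⟨a, ha⟩
    exact ⟨Or.inr, fun h => h.resolve_left ha⟩
  rw [hins]
  apply le_antisymm
  · refine le_min (coverCost_mono (Set.subset_insert v X)) ?_
    obtain ⟨T, hT, hXT, hc⟩ := exists_ncard_eq_coverCost (G.induce {v}ᶜ)
      ((↑) ⁻¹' X ∪ (↑) ⁻¹' G.neighborSet v)
    rw [← hc, ← Set.ncard_image_of_injective T Subtype.val_injective]
    refine coverCost_le (fun a b hab => ?_) fun a ha => ?_
    · by_cases ha : a = v
      · subst ha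
        exact Or.inr ⟨⟨b, hab.ne'⟩, hXT (Or.inr hab), rfl⟩
      by_cases hb : b = v
      · subst hb
        exact Or.inl ⟨⟨a, ha⟩, hXT (Or.inr hab.symm), rfl⟩
      have := hT (v := ⟨a, ha⟩) (w := ⟨b, hb⟩) hab
      exact this.imp (fun h => ⟨_, h, rfl⟩) fun h => ⟨_, h, rfl⟩
    · exact ⟨⟨a, fun h => hv (h ▸ ha)⟩, hXT (Or.inl ha), rfl⟩
  · obtain ⟨S, hS, hX, hc⟩ := exists_ncard_eq_coverCost G X
    rw [← hc]
    by_cases hvS : v ∈ S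
    · exact min_le_of_left_le (coverCost_le hS (Set.insert_subset hvS hX))
    · have h := coverCost_le (X := (↑) ⁻¹' X ∪ (↑) ⁻¹' G.neighborSet v)
        (isVertexCover_induce hS {v}ᶜ) (Set.union_subset (Set.preimage_mono hX)
          (Set.preimage_mono fun b hb => (hS hb).resolve_left hvS))
      rw [ncard_preimage_val] at h
      exact min_le_of_right_le (h.trans (Set.ncard_le_ncard Set.inter_subset_right))

end Decomposition

/-! ### The bound -/

/-- The number of vertices that suffice to raise the minimum size of a vertex cover containing a
set `X` in a graph of elimination distance at most `d`, if that size exceeds the vertex cover number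
by at most `j`. -/
def blockingBound : ℕ → ℕ → ℕ
  | 0, j => j + 2
  | d + 1, j => blockingBound d j + blockingBound d (j + 1)

theorem two_mul_blockingBound (d j : ℕ) :
    2 * blockingBound d j = 2 ^ d * (2 * j + d + 4) := by
  induction d generalizing j with
  | zero => simp only [blockingBound]; ring
  | succ d ih =>
    rw [blockingBound, mul_add, ih, ih]
    ring

theorem add_two_le_blockingBound (d j : ℕ) : j + 2 ≤ blockingBound d j := by
  induction d generalizing j with
  | zero => exact le_rfl
  | succ d ih => exact (ih j).trans (Nat.le_add_right _ _)

theorem blockingBound_zero_right_le (d : ℕ) : blockingBound d 0 ≤ (d + 1) * 2 ^ d + 1 := by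
  have h := two_mul_blockingBound d 0
  rcases d with _ | _ | d
  · norm_num at h ⊢
    omega
  · norm_num at h ⊢
    omega
  · have h' : 2 * blockingBound (d + 2) 0 = 2 ^ (d + 2) * (2 * 0 + (d + 2) + 4) := h
    -- The difference of the two sides is `d * 2 ^ (d + 2)`.
    have : 2 ^ (d + 2) * (2 * 0 + (d + 2) + 4) ≤ 2 * ((d + 2 + 1) * 2 ^ (d + 2)) := by
      nlinarith [Nat.zero_le (d * 2 ^ (d + 2))]
    show blockingBound (d + 2) 0 ≤ (d + 2 + 1) * 2 ^ (d + 2) + 1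
    omega

/-- The step of the induction that deletes a vertex `v`: to raise the minimum size of a vertex cover
that contains `X`, it has to be raised for the covers containing `v` and for those avoiding `v`. -/
theorem exists_subset_coverCost_lt_of_deleteVert {V : Type*} [Finite V] {G : SimpleGraph V}
    {X Y : Set V} {j : ℕ} {B : ℕ → ℕ} (hB : ∀ i, 0 < B i) (v : V)
    (ih : ∀ (i : ℕ) (X' Y' : Set ({v}ᶜ : Set V)),
      coverCost (G.induce {v}ᶜ) X' ≤ coverCost (G.induce {v}ᶜ) ∅ + i →
      coverCost (G.induce {v}ᶜ) X' < coverCost (G.induce {v}ᶜ) (X' ∪ Y') →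
      ∃ Z ⊆ Y', Z.ncard ≤ B i ∧
        coverCost (G.induce {v}ᶜ) X' < coverCost (G.induce {v}ᶜ) (X' ∪ Z))
    (hX : coverCost G X ≤ coverCost G ∅ + j) (hY : coverCost G X < coverCost G (X ∪ Y)) :
    ∃ Z ⊆ Y, Z.ncard ≤ B j + B (j + 1) ∧ coverCost G X < coverCost G (X ∪ Z) := by
  set H := G.induce {v}ᶜ
  set X' : Set ({v}ᶜ : Set V) := (↑) ⁻¹' X
  set Y' : Set ({v}ᶜ : Set V) := (↑) ⁻¹' Y
  set N : Set ({v}ᶜ : Set V) := (↑) ⁻¹' G.neighborSet v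
  have hopt : coverCost G ∅ ≤ coverCost H ∅ + 1 := by
    rw [coverCost_of_notMem (Set.notMem_empty v), Set.preimage_empty]
    exact min_le_left _ _
  have hXY : ((↑) ⁻¹' (X ∪ Y) : Set ({v}ᶜ : Set V)) = X' ∪ Y' := rfl
  have hXim : ∀ Z : Set ({v}ᶜ : Set V),
      ((↑) ⁻¹' (X ∪ (↑) '' Z) : Set ({v}ᶜ : Set V)) = X' ∪ Z :=
    fun Z => preimage_val_union_image _ X Z
  have hsub : ∀ Z ⊆ Y', ((↑) '' Z : Set V) ⊆ Y := fun Z hZ => Set.image_subset_iff.2 hZ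
  have hnc : ∀ Z : Set ({v}ᶜ : Set V), ((↑) '' Z : Set V).ncard = Z.ncard :=
    fun Z => Set.ncard_image_of_injective Z Subtype.val_injective
  -- The covers that contain `v`.
  have hin : coverCost G X < coverCost H (X' ∪ Y') + 1 →
      ∃ Z ⊆ Y', Z.ncard ≤ B j ∧ coverCost G X < coverCost H (X' ∪ Z) + 1 := by
    intro hlt
    by_cases ha : coverCost G X < coverCost H X' + 1
    · exact ⟨∅, Set.empty_subset _, by simp, by simpa using ha⟩
    · obtain ⟨Z, hZY, hZ, hZc⟩ := ih j X' Y' (by omega) (by omega)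
      have : coverCost G X ≤ coverCost H X' + 1 := by
        by_cases hvX : v ∈ X
        · exact (coverCost_of_mem hvX).le
        · exact (coverCost_of_notMem hvX).le.trans (min_le_left _ _)
      exact ⟨Z, hZY, hZ, by omega⟩
  by_cases hvX : v ∈ X
  · rw [coverCost_of_mem (Set.mem_union_left Y hvX), hXY] at hY
    obtain ⟨Z, hZY, hZ, hZc⟩ := hin hY
    refine ⟨_, hsub Z hZY, by rw [hnc]; omega, ?_⟩
    rwa [coverCost_of_mem (Set.mem_union_left _ hvX), hXim]
  by_cases hvY : v ∈ Y
  · rw [coverCost_of_mem (Set.mem_union_right X hvY), hXY] at hY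
    obtain ⟨Z, hZY, hZ, hZc⟩ := hin hY
    refine ⟨insert v ((↑) '' Z), Set.insert_subset hvY (hsub Z hZY), ?_, ?_⟩
    · have h1 := Set.ncard_insert_le v ((↑) '' Z)
      have h2 := hB (j + 1)
      rw [hnc] at h1
      omega
    · rw [coverCost_of_mem (Set.mem_union_right X (Set.mem_insert v _))]
      refine hZc.trans_le (Nat.add_le_add_right (coverCost_mono ?_) 1)
      rw [← hXim]
      exact Set.preimage_mono (Set.union_subset_union_right X (Set.subset_insert _ _))
  · rw [coverCost_of_notMem (by simp [hvX, hvY] : v ∉ X ∪ Y), lt_min_iff, hXY] at hY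
    obtain ⟨Z₁, hZ₁Y, hZ₁, hZ₁c⟩ := hin hY.1
    -- The covers that avoid `v`.
    have hout : ∃ Z ⊆ Y', Z.ncard ≤ B (j + 1) ∧ coverCost G X < coverCost H (X' ∪ Z ∪ N) := by
      by_cases hb : coverCost G X < coverCost H (X' ∪ N)
      · exact ⟨∅, Set.empty_subset _, by simp, by simpa using hb⟩
      · have hXN : coverCost G X ≤ coverCost H (X' ∪ N) :=
          (coverCost_of_notMem hvX).le.trans (min_le_right _ _)
        have hYN : coverCost G X < coverCost H (X' ∪ N ∪ Y') := by
          rw [Set.union_right_comm]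
          exact hY.2
        obtain ⟨Z, hZY, hZ, hZc⟩ := ih (j + 1) (X' ∪ N) Y' (by omega) (by omega)
        exact ⟨Z, hZY, hZ, by rw [Set.union_right_comm]; omega⟩
    obtain ⟨Z₂, hZ₂Y, hZ₂, hZ₂c⟩ := hout
    have hv : v ∉ X ∪ ((↑) '' (Z₁ ∪ Z₂) : Set V) := by
      rintro (h | ⟨w, -, hw⟩)
      · exact hvX h
      · exact w.2 hw
    refine ⟨(↑) '' (Z₁ ∪ Z₂), hsub _ (Set.union_subset hZ₁Y hZ₂Y), ?_, ?_⟩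
    · have := Set.ncard_union_le Z₁ Z₂
      rw [hnc]
      omega
    · rw [coverCost_of_notMem hv, lt_min_iff, hXim]
      exact ⟨hZ₁c.trans_le (Nat.add_le_add_right (coverCost_mono (by grind)) 1),
        hZ₂c.trans_le (coverCost_mono (by grind))⟩

/-- The statement about pairs `X`, `Y` that generalizes the bound on minimal blocking sets, which is
the case `X = ∅`, `j = 0`, and that can be proved by induction along the elimination. -/
theorem exists_subset_coverCost_lt_of_elimDist {V : Type u} [Finite V] {G : SimpleGraph V}
    {d j : ℕ} {X Y : Set V} (hd : elimDist classLP V G ≤ d)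
    (hX : coverCost G X ≤ coverCost G ∅ + j) (hY : coverCost G X < coverCost G (X ∪ Y)) :
    ∃ Z ⊆ Y, Z.ncard ≤ blockingBound d j ∧ coverCost G X < coverCost G (X ∪ Z) := by
  induction hn : Nat.card V using Nat.strong_induction_on generalizing V d j with
  | _ n ih =>
  subst hn
  rw [elimDist] at hd
  split_ifs at hd with hC hconn
  · have := Fintype.ofFinite V
    obtain ⟨Z, hZY, hZ, hZc⟩ :=
      exists_subset_coverCost_lt_of_signedBound j (signedBound_of_classLP hC) hX hY
    exact ⟨Z, hZY, hZ.trans (add_two_le_blockingBound d j), hZc⟩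
  · obtain _ | d := d
    · simp at hd
    have : Nonempty V := hconn.nonempty
    obtain ⟨v, hv⟩ := ENat.exists_eq_iInf
      fun v : V => elimDist classLP ({v}ᶜ : Set V) (G.induce ({v}ᶜ : Set V))
    rw [← hv, Nat.cast_add, Nat.cast_one, ENat.add_le_add_iff_right ENat.one_ne_top] at hd
    refine exists_subset_coverCost_lt_of_deleteVert (B := blockingBound d)
      (fun i => (Nat.succ_pos _).trans_le (add_two_le_blockingBound d i)) v
      (fun i X' Y' hX' hY' => ?_) hX hY
    exact ih _ (natCard_deleteVert_lt v) hd hX' hY' rfl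
  · obtain ⟨c, hcX, hcY⟩ := exists_component_coverCost_lt hX hY
    obtain ⟨Z, hZY, hZ, hZc⟩ := ih _ (natCard_supp_lt hconn c)
      ((le_iSup (fun c : G.ConnectedComponent => elimDist classLP c.supp (G.induce c.supp))
        c).trans hd) hcX hcY rfl
    refine ⟨(↑) '' Z, Set.image_subset_iff.2 hZY, ?_, coverCost_lt_of_component hZc⟩
    rwa [Set.ncard_image_of_injective Z Subtype.val_injective]

theorem classBlockingNum_elimDistLE_le (d : ℕ) :
    classBlockingNum (elimDistLE classLP.{u} d) ≤ blockingBound d 0 := by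
  refine iSup_le fun V => iSup_le fun _ => iSup_le fun G => iSup_le fun hG =>
    iSup_le fun Y => iSup_le fun hY => ?_
  obtain ⟨Z, hZY, hZ, hZc⟩ := exists_subset_coverCost_lt_of_elimDist (j := 0) (X := ∅) (Y := Y)
    hG le_rfl (by simpa using isBlockingSet_iff.1 hY.1)
  rw [Set.empty_union] at hZc
  have hYZ : Y = Z := by
    by_contra hne
    exact hY.2 Z (hZY.ssubset_of_ne (Ne.symm hne)) (isBlockingSet_iff.2 hZc)
  rw [hYZ, ← Z.toFinite.cast_ncard_eq, Nat.cast_le]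
  exact hZ

theorem classBlockingNum_classLP : classBlockingNum classLP.{u} = 2 := by
  apply le_antisymm
  · refine le_trans ?_ (classBlockingNum_elimDistLE_le 0)
    refine iSup_le fun V => iSup_le fun _ => iSup_le fun G => iSup_le fun hG => ?_
    have hG0 : elimDistLE classLP 0 V G := by
      rw [elimDistLE, elimDist, if_pos hG]
      exact bot_le
    exact le_iSup_of_le V (le_iSup_of_le inferInstance (le_iSup_of_le G (le_iSup_of_le hG0 le_rfl)))
  · refine le_iSup_of_le (ULift.{u} Bool) (le_iSup_of_le inferInstance
      (le_iSup_of_le ⊤ (le_iSup_of_le classLP_top_bool ?_)))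
    refine le_trans ?_ (le_iSup_of_le Set.univ
      (le_iSup_of_le isMinimalBlockingSet_top_bool le_rfl))
    rw [Set.encard_univ]
    simp

end VCBlocking

/-- For every `d`, the largest size of a minimal blocking set of a graph of elimination distance
at most `d` to the class `classLP` is at most `(β + d - 1) * 2 ^ d + 1 = (d + 1) * 2 ^ d + 1`,
where `β = 2` is the largest size of a minimal blocking set of a graph in `classLP`. -/
theorem mainTheorem6 (d : ℕ) :
    VCBlocking.classBlockingNum VCBlocking.classLP.{u} = 2 ∧
    VCBlocking.classBlockingNum (VCBlocking.elimDistLE VCBlocking.classLP.{u} d) ≤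
      (VCBlocking.classBlockingNum VCBlocking.classLP.{u} + (d : ℕ∞) - 1) * 2 ^ d + 1 ∧
    (VCBlocking.classBlockingNum VCBlocking.classLP.{u} + (d : ℕ∞) - 1) * 2 ^ d + 1 =
      ((d : ℕ∞) + 1) * 2 ^ d + 1 := by
  have heq : (VCBlocking.classBlockingNum VCBlocking.classLP.{u} + (d : ℕ∞) - 1) * 2 ^ d + 1 =
      ((d : ℕ∞) + 1) * 2 ^ d + 1 := by
    have h : (2 + (d : ℕ∞) - 1) = (d : ℕ∞) + 1 := by
      have : 2 + d - 1 = d + 1 := by omega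
      exact_mod_cast congrArg (Nat.cast : ℕ → ℕ∞) this
    rw [VCBlocking.classBlockingNum_classLP, h]
  refine ⟨VCBlocking.classBlockingNum_classLP, ?_, heq⟩
  rw [heq]
  refine (VCBlocking.classBlockingNum_elimDistLE_le d).trans ?_
  exact_mod_cast VCBlocking.blockingBound_zero_right_le d
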